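/- Let $\gamma\ge 1$, $m\ge 0$, and let $N\subseteq\mathbb R^\gamma$, $Z\subseteq\mathbb R^m$ be open sets containing the origin. On $\mathcal X=N\times Z$, with state $\zeta=(\eta,z)$, consider the control system $$\dot\zeta=f(\zeta)+g(\zeta)u:\qquad \dot\eta_i=\eta_{i+1}\ (1\le i<\gamma),\quad \dot\eta_\gamma=u,\quad \dot z=\omega(\eta,z),$$ with scalar input $u$, where $\omega:\mathcal X\to\mathbb R^m$ is $C^1$ and $\partial\omega/\partial\eta_i=0$ on $\mathcal X$ for $i=3,\dots,\gamma$. Let $\psi:Z\to N$ be differentiable with $\psi(0)=0$, let $\mathcal M_\psi=\{(\eta,z)\in\mathcal X:\eta=\psi(z)\}$ and $y(\zeta)=\eta_1-\psi_1(z)$. Assume that $y$ has relative degree $\gamma$ at the origin: the iterated Lie derivatives $L_f^ky$, $0\le k\le\gamma-1$, are $C^1$ on $\mathcal X$, $L_gL_f^ky\equiv0$ on $\mathcal X$ for $0\le k\le\gamma-2$, and $L_gL_f^{\gamma-1}y(0)\ne0$. Put $e(\zeta)=(y,L_fy,\dots,L_f^{\gamma-1}y)(\zeta)$, and assume that $\mathcal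 M_\psi$ is a zeroing manifold of $y$, i.e. $e\equiv0$ on $\mathcal M_\psi$. A system $\dot x=F(x)$ on $X$ is called exponentially stable on a set $D$ if there are $M,\lambda>0$ such that every solution in $X$ with $x(0)\in D$ satisfies $\|x(t)\|\le Me^{-\lambda t}\|x(0)\|$ at all times $t\ge 0$ at which it is defined. Let $V:\mathbb R^\gamma\to\mathbb R$ be a control Lyapunov function for the output: for constants $k_1,k_2,k_3>0$ and all $\zeta\in\mathcal X$, $V$ is differentiable at $e(\zeta)$, $k_1\|e(\zeta)\|^2\le V(e(\zeta))\le k_2\|e(\zeta)\|^2$, and $\inf_v\dot V(\zeta,v)\le-k_3V(e(\zeta))$, where $\dot V(\zeta,v)=\frac{\partial (V\circ e)}{\partial\zeta}(\zeta)\,(f(\zeta)+g(\zeta)v)$. Let $\mathcal K$ be the set of all feedback controllers $k$ with $\dot V(\zeta,k(\zeta))\le-k_3V(e(\zeta))$ for all $\zeta\in\mathcal X$. **Theorem.** Suppose that the zero dynamics $\dot z=\omega(\psi(z),z)$ on $Z$ are exponentially stable on a neighbourhood of $0$. Let $k\in\mathcal K$. 1. The closed-loop system $\dot\zeta=f(\zeta)+g(\zeta)k(\zeta)$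 on $\mathcal X$ is exponentially stable on some neighbourhood $D$ of the origin. If moreover $k$ is locally Lipschitz, then from every point of $D$ there starts a solution that is defined for all $t\ge0$. 2. Suppose in addition that $N=\mathbb R^\gamma$, $Z=\mathbb R^m$, that the zero dynamics are exponentially stable on all of $\mathbb R^m$, that $\omega$ is globally Lipschitz as a function of $(e,z)$, i.e. for some $L$, $\|\omega(\zeta)-\omega(\zeta')\|\le L\,\|(e(\zeta),z)-(e(\zeta'),z')\|$ for all $\zeta=(\eta,z)$ and $\zeta'=(\eta',z')$, and that for some $C$, $\|(e(\zeta),z)\|\le C\|\zeta\|$ and $\|\zeta\|\le C\|(e(\zeta),z)\|$ for all $\zeta=(\eta,z)$. Then the closed-loop system is exponentially stable on all of $\mathbb R^\gamma\times\mathbb R^m$; if moreover $k$ is locally Lipschitz, then from every point there starts a solution that is defined for all $t\ge0$. -/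

import Mathlib

open Set Filter Topology

noncomputable section

namespace ZDP

/-- Euclidean space `ℝⁿ`. -/
abbrev Eu (n : ℕ) : Type := EuclideanSpace ℝ (Fin n)

/-- The space of the full state `ζ = (η, z) ∈ ℝ^γ × ℝ^m`. Its product norm is the maximum of the two
Euclidean norms; it is equivalent to the Euclidean norm of `ℝ^(γ+m)`. -/
abbrev State (γ m : ℕ) : Type := Eu γ × Eu m

/-! ### Solutions and exponential stability -/

section General

variable {E : Type*} [NormedAddCommGroup E] [NormedSpace ℝ E]

/-- `c` is a (classical) solution of `ċ = F(c)` on the time interval `I`, with values in `X`. -/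
def IsSolutionOn (F : E → E) (X : Set E) (c : ℝ → E) (I : Set ℝ) : Prop :=
  ∀ t ∈ I, c t ∈ X ∧ HasDerivWithinAt c (F (c t)) I t

/-- `ẋ = F(x)` on the state space `X` is exponentially stable (to the origin) on the domain `D`:
there are `M, lam > 0` such that every solution that starts in `D` obeys
`‖x(t)‖ ≤ M exp(-lam t) ‖x(0)‖` for as long as it is defined. -/
def ExpStableOn (F : E → E) (X D : Set E) : Prop :=
  ∃ M > 0, ∃ lam > 0, ∀ (c : ℝ → E) (T : ℝ), IsSolutionOn F X c (Ico 0 T) → c 0 ∈ D →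
    ∀ t ∈ Ico 0 T, ‖c t‖ ≤ M * Real.exp (-lam * t) * ‖c 0‖

/-- From every point of `D` there starts a solution of `ẋ = F(x)` in `X` for all times `t ≥ 0`. -/
def ForwardCompleteOn (F : E → E) (X D : Set E) : Prop :=
  ∀ x₀ ∈ D, ∃ c : ℝ → E, c 0 = x₀ ∧ IsSolutionOn F X c (Ici 0)

/-- The Lie derivative `L_F h = (∂h/∂x) F` of a real function `h` along a vector field `F`. -/
def lieDeriv (F : E → E) (h : E → ℝ) : E → ℝ := fun x => fderiv ℝ h x (F x)

/-- The output `y` of `ẋ = f(x) + g(x) u` on `X` has relative degree `r ≥ 1` at `x₀`: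
`L_g L_f^k y ≡ 0` for `0 ≤ k ≤ r - 2`, and `L_g L_f^(r-1) y ≠ 0` at `x₀`. The functions
`y, L_f y, …, L_f^(r-1) y` are required to be `C¹`, so that all these Lie derivatives exist. -/
structure HasRelativeDegreeAt (f g : E → E) (y : E → ℝ) (X : Set E) (r : ℕ) (x₀ : E) : Prop where
  pos : 1 ≤ r
  smooth : ∀ k < r, ContDiffOn ℝ 1 ((lieDeriv f)^[k] y) X
  vanish : ∀ k, k + 2 ≤ r → ∀ x ∈ X, lieDeriv g ((lieDeriv f)^[k] y) x = 0
  nonzero : lieDeriv g ((lieDeriv f)^[r - 1] y) x₀ ≠ 0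

/-- The error coordinates `e = (y, ẏ, …, y^(γ-1)) = (y, L_f y, …, L_f^(γ-1) y)`. -/
def errorMap (γ : ℕ) (f : E → E) (y : E → ℝ) : E → Eu γ :=
  fun x => WithLp.toLp 2 fun i : Fin γ => ((lieDeriv f)^[(i : ℕ)] y) x

/-- `V̇(x, v)`, the derivative of `V(e(x))` along `ẋ = f(x) + g(x) v`. -/
def Vdot {γ : ℕ} (f g : E → E) (e : E → Eu γ) (V : Eu γ → ℝ) (x : E) (v : ℝ) : ℝ :=
  fderiv ℝ (V ∘ e) x (f x + v • g x)

/-- `V` is a control Lyapunov function for the coordinates `e`, with constants `k₁, k₂, k₃ > 0`: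
`k₁ ‖e‖² ≤ V(e) ≤ k₂ ‖e‖²` and `inf_v V̇(x, v) ≤ -k₃ V(e)`, at all `e = e(x)` with `x ∈ X`. -/
structure IsCLF {γ : ℕ} (f g : E → E) (e : E → Eu γ) (X : Set E) (V : Eu γ → ℝ)
    (k₁ k₂ k₃ : ℝ) : Prop where
  pos₁ : 0 < k₁
  pos₂ : 0 < k₂
  pos₃ : 0 < k₃
  diff : ∀ x ∈ X, DifferentiableAt ℝ V (e x)
  lower : ∀ x ∈ X, k₁ * ‖e x‖ ^ 2 ≤ V (e x)
  upper : ∀ x ∈ X, V (e x) ≤ k₂ * ‖e x‖ ^ 2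
  decrease : ∀ x ∈ X, (⨅ v : ℝ, ((Vdot f g e V x v : ℝ) : EReal)) ≤ ((-k₃ * V (e x) : ℝ) : EReal)

/-- The class `𝒦` of output exponentially stabilizing feedback controllers:
all `k` with `V̇(x, k(x)) ≤ -k₃ V(e(x))`. -/
def stabilizingControllers {γ : ℕ} (f g : E → E) (e : E → Eu γ) (X : Set E) (V : Eu γ → ℝ)
    (k₃ : ℝ) : Set (E → ℝ) :=
  {k | ∀ x ∈ X, Vdot f g e V x (k x) ≤ -k₃ * V (e x)}

/-- The closed-loop vector field `f(x) + g(x) k(x)`. -/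
def closedLoop (f g : E → E) (k : E → ℝ) : E → E := fun x => f x + k x • g x

end General

/-! ### The actuation decomposition `η̇ = F η + G u`, `ż = ω(η, z)` -/

/-- The shift `F η = (η₂, …, η_γ, 0)`. -/
def shift {γ : ℕ} (η : Eu γ) : Eu γ :=
  WithLp.toLp 2 fun i : Fin γ => if h : (i : ℕ) + 1 < γ then η ⟨(i : ℕ) + 1, h⟩ else 0

/-- The drift `f(η, z) = (F η, ω(η, z))`. -/
def drift {γ m : ℕ} (ω : State γ m → Eu m) : State γ m → State γ m :=
  fun ζ => (shift ζ.1, ω ζ)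

/-- The input vector field `g = (G, 0)`, with `G = (0, …, 0, 1)`. -/
def inputField (γ m : ℕ) : State γ m → State γ m :=
  fun _ => (WithLp.toLp 2 fun i : Fin γ => if (i : ℕ) + 1 = γ then 1 else 0, 0)

/-- The output `y = η₁ - ψ₁(z)`. -/
def output {γ m : ℕ} [NeZero γ] (ψ : Eu m → Eu γ) : State γ m → ℝ :=
  fun ζ => ζ.1 0 - ψ ζ.2 0

/-- The manifold `M_ψ = {(η, z) ∈ N × Z : η - ψ(z) = 0}`. -/
def manifold {γ m : ℕ} (N : Set (Eu γ)) (Z : Set (Eu m)) (ψ : Eu m → Eu γ) : Set (State γ m) :=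
  {ζ | ζ ∈ N ×ˢ Z ∧ ζ.1 - ψ ζ.2 = 0}

/-- The vector field `z ↦ ω(ψ(z), z)` of the zero dynamics. -/
def zeroDynamics {γ m : ℕ} (ω : State γ m → Eu m) (ψ : Eu m → Eu γ) : Eu m → Eu m :=
  fun z => ω (ψ z, z)

/-- The error coordinates of the output `η₁ - ψ₁(z)`. -/
def error {γ m : ℕ} [NeZero γ] (ω : State γ m → Eu m) (ψ : Eu m → Eu γ) : State γ m → Eu γ :=
  errorMap γ (drift ω) (output ψ)

/-- The coordinates `(e, z)` of the state `(η, z)`. -/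
def errorCoord {γ m : ℕ} [NeZero γ] (ω : State γ m → Eu m) (ψ : Eu m → Eu γ) :
    State γ m → State γ m :=
  fun ζ => (error ω ψ ζ, ζ.2)

end ZDP

end

/-! Work in the coordinates `Φ = (e, z)` (`errorCoord`). Under a controller of class `𝒦` the
function `exp (k₃ t) V(e)` is nonincreasing, so `e` decays exponentially
(`IsCLF.exists_norm_error_le`). As `e` vanishes on the zeroing manifold, `Φ(ψ z, z) = (0, z)`: a
state `(η, z)` and its companion `(ψ z, z)` differ in `Φ` exactly by `e`. Where `Φ⁻¹` and `ω` are
Lipschitz, `‖ω(η, z) - ω(ψ z, z)‖ ≤ L ‖e‖`, so `z` follows the zero dynamics up to an exponentially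
small error.

Near the origin `Φ` is bi-Lipschitz (`exists_errorCoord_biLipschitz`). Since `ω` ignores `η₃, …,
η_γ`, the matrix `∂e/∂η` is lower triangular; its first diagonal entry is 1 and all others equal
`L_g L_f^(γ-1) y`, nonzero at the origin. Globally, the assumed linear bounds take over this role.

The perturbation step (`exp_decay_of_approx_solution`) uses no converse Lyapunov function: over a
window of fixed length the zero dynamics at least halve the norm, Gronwall controls the deviation,
and the windows are iterated. Global existence comes from cutting off the field outside a ball that
the a priori decay bound keeps solutions from leaving. -/

namespace ZDP

/-! ### Global solutions from a priori bounds -/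

section General

variable {E : Type*} [NormedAddCommGroup E] [NormedSpace ℝ E]

theorem IsSolutionOn.continuousOn {F : E → E} {X : Set E} {c : ℝ → E} {I : Set ℝ}
    (h : IsSolutionOn F X c I) : ContinuousOn c I :=
  fun t ht => (h t ht).2.continuousWithinAt

theorem IsSolutionOn.mono {F : E → E} {X Y : Set E} {c : ℝ → E} {I J : Set ℝ}
    (h : IsSolutionOn F X c I) (hXY : X ⊆ Y) (hJ : J ⊆ I) : IsSolutionOn F Y c J :=
  fun t ht => ⟨hXY (h t (hJ ht)).1, (h t (hJ ht)).2.mono hJ⟩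

theorem ExpStableOn.mono {F : E → E} {X Y D D' : Set E} (h : ExpStableOn F Y D)
    (hXY : X ⊆ Y) (hD : D' ⊆ D) : ExpStableOn F X D' := by
  obtain ⟨M, hM, lam, hlam, h⟩ := h
  exact ⟨M, hM, lam, hlam, fun c T hc h0 => h c T (hc.mono hXY subset_rfl) (hD h0)⟩

/-- A bounded Lipschitz vector field has solutions for all nonnegative times. -/
theorem exists_solution_Ici_of_lipschitz_of_bounded [CompleteSpace E] {F : E → E} {K B : NNReal}
    (hF : LipschitzWith K F) (hB : ∀ x, ‖F x‖ ≤ B) (x₀ : E) :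
    ∃ c : ℝ → E, c 0 = x₀ ∧ IsSolutionOn F univ c (Ici 0) := by
  have key : ∀ n : ℕ, ∃ c : ℝ → E, c 0 = x₀ ∧
      ∀ t ∈ Icc (0 : ℝ) (n + 1), HasDerivWithinAt c (F (c t)) (Icc 0 (n + 1)) t := by
    intro n
    have hn : (0 : ℝ) ≤ n + 1 := by positivity
    -- At speed at most `B` a solution stays within distance `B (n + 1)` of `x₀`, so one
    -- Picard–Lindelöf step covers the whole interval.
    have hpl : IsPicardLindelof (fun _ => F) (tmin := 0) (tmax := n + 1) ⟨0, ⟨le_rfl, hn⟩⟩ x₀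
        (B * (n + 1)) 0 B K :=
      { lipschitzOnWith := fun _ _ => hF.lipschitzOnWith
        continuousOn := fun _ _ => continuousOn_const
        norm_le := fun _ _ x _ => hB x
        mul_max_le := by simp [hn] }
    exact hpl.exists_eq_forall_mem_Icc_hasDerivWithinAt₀
  choose c h0 hc using key
  have hright : ∀ n : ℕ, ∀ b : ℝ, b ≤ n + 1 → ∀ t ∈ Ico 0 b,
      HasDerivWithinAt (c n) (F (c n t)) (Ici t) t := by
    intro n b hb t ht
    refine ((hc n t ⟨ht.1, (ht.2.trans_le hb).le⟩).mono (Icc_subset_Icc_left ht.1)).mono_of_mem_nhdsWithin ?_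
    exact Icc_mem_nhdsGE (ht.2.trans_le hb)
  have huniq : ∀ n k : ℕ, n ≤ k → EqOn (c n) (c k) (Icc 0 (n + 1)) := by
    intro n k hnk
    have hnk' : (n : ℝ) + 1 ≤ k + 1 := by exact_mod_cast Nat.succ_le_succ hnk
    refine ODE_solution_unique_of_mem_Icc_right (v := fun _ => F) (s := fun _ => univ) (K := K)
      (fun _ _ => hF.lipschitzOnWith) (fun t ht => (hc n t ht).continuousWithinAt)
      (hright n _ le_rfl) (fun _ _ => mem_univ _)
      (fun t ht => ((hc k t ⟨ht.1, ht.2.trans hnk'⟩).continuousWithinAt).mono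
        (Icc_subset_Icc_right hnk'))
      (hright k _ hnk') (fun _ _ => mem_univ _) ?_
    rw [h0, h0]
  have heq : ∀ n : ℕ, ∀ t ∈ Icc (0 : ℝ) (n + 1), c ⌊t⌋₊ t = c n t := by
    intro n t ht
    rcases le_total ⌊t⌋₊ n with h | h
    · exact huniq _ _ h ⟨ht.1, (Nat.lt_floor_add_one t).le⟩
    · exact (huniq _ _ h ht).symm
  -- The piece of index `⌊t⌋₊` lives on `[0, ⌊t⌋₊ + 1]`, which leaves room to the right of `t` for
  -- the derivative.
  refine ⟨fun t => c ⌊t⌋₊ t, by simp [h0], fun t ht => ⟨mem_univ _, ?_⟩⟩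
  have ht0 : (0 : ℝ) ≤ t := ht
  have ht1 : t < (⌊t⌋₊ : ℝ) + 1 := Nat.lt_floor_add_one t
  have hnhds : Icc (0 : ℝ) (⌊t⌋₊ + 1) ∈ 𝓝[Ici 0] t := by
    rw [← Ici_inter_Iic]
    exact inter_mem self_mem_nhdsWithin (mem_nhdsWithin_of_mem_nhds (Iic_mem_nhds ht1))
  refine HasDerivWithinAt.mono_of_mem_nhdsWithin ?_ hnhds
  exact (hc ⌊t⌋₊ t ⟨ht0, ht1.le⟩).congr (fun s hs => heq _ s hs) rfl

/-- A field that is Lipschitz on a ball agrees there with a bounded, globally Lipschitz one. -/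
theorem exists_bounded_lipschitz_eqOn_closedBall [FiniteDimensional ℝ E] {F : E → E} {K : NNReal}
    {R : ℝ} (hR : 0 ≤ R) (hF : LipschitzOnWith K F (Metric.closedBall 0 R)) :
    ∃ (G : E → E) (K' B : NNReal), LipschitzWith K' G ∧ (∀ x, ‖G x‖ ≤ B) ∧
      EqOn F G (Metric.closedBall 0 R) := by
  obtain ⟨G, hG, hFG⟩ := hF.extend_finite_dimension
  set C := lipschitzExtensionConstant E * K
  -- A 1-Lipschitz cutoff: 1 on the ball of radius `R`, 0 from radius `R + 1` on.
  set s : E → ℝ := fun x => max 0 (min 1 (R + 1 - ‖x‖))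
  have hs0 : ∀ x, 0 ≤ s x := fun x => le_max_left _ _
  have hs1 : ∀ x, s x ≤ 1 := fun x => max_le zero_le_one (min_le_left _ _)
  have hsout : ∀ x, R + 1 ≤ ‖x‖ → s x = 0 := fun x hx =>
    max_eq_left ((min_le_right _ _).trans (by linarith))
  have hsin : ∀ x, ‖x‖ ≤ R → s x = 1 := fun x hx => by
    simp only [s]
    rw [min_eq_left (by linarith), max_eq_right zero_le_one]
  have hsl : ∀ x y, |s x - s y| ≤ ‖x - y‖ := by
    intro x y
    refine (abs_max_sub_max_le_max _ _ _ _).trans (max_le (by simp) ?_)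
    refine (abs_min_sub_min_le_max _ _ _ _).trans (max_le (by simp) ?_)
    rw [show R + 1 - ‖x‖ - (R + 1 - ‖y‖) = -(‖x‖ - ‖y‖) by ring, abs_neg]
    exact abs_norm_sub_norm_le x y
  set B : NNReal := ‖G 0‖₊ + C * (R + 1).toNNReal
  have hB : ∀ x, ‖x‖ ≤ R + 1 → ‖G x‖ ≤ B := by
    intro x hx
    have h1 := hG.dist_le_mul x 0
    rw [dist_eq_norm, dist_zero_right] at h1
    have h2 : ‖G x‖ ≤ ‖G 0‖ + ‖G x - G 0‖ := by
      simpa using norm_add_le (G 0) (G x - G 0)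
    have h3 : (C : ℝ) * ‖x‖ ≤ C * (R + 1) := by gcongr
    rw [NNReal.coe_add, NNReal.coe_mul, coe_nnnorm, Real.coe_toNNReal _ (by linarith)]
    linarith
  refine ⟨fun x => s x • G x, C + B, B, ?_, ?_, ?_⟩
  · have main : ∀ x y, ‖y‖ ≤ R + 1 → ‖s x • G x - s y • G y‖ ≤ (C + B : NNReal) * ‖x - y‖ := by
      intro x y hy
      have h1 := hG.dist_le_mul x y
      rw [dist_eq_norm, dist_eq_norm] at h1
      have h2 : s x • G x - s y • G y = s x • (G x - G y) + (s x - s y) • G y := by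
        rw [smul_sub, sub_smul]; abel
      rw [h2]
      refine (norm_add_le _ _).trans ?_
      rw [norm_smul, norm_smul, Real.norm_eq_abs, Real.norm_eq_abs, abs_of_nonneg (hs0 x),
        NNReal.coe_add, add_mul]
      refine add_le_add ?_ ?_
      · exact (mul_le_of_le_one_left (norm_nonneg _) (hs1 x)).trans h1
      · rw [mul_comm]
        exact mul_le_mul (hB y hy) (hsl x y) (abs_nonneg _) B.2
    refine LipschitzWith.of_dist_le_mul fun x y => ?_
    rw [dist_eq_norm, dist_eq_norm]
    rcases le_total ‖y‖ (R + 1) with hy | hy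
    · exact main x y hy
    · rcases le_total ‖x‖ (R + 1) with hx | hx
      · rw [norm_sub_rev, norm_sub_rev x y]
        exact main y x hx
      · simp only [hsout x hx, hsout y hy, zero_smul, sub_self, norm_zero]
        positivity
  · intro x
    rw [norm_smul, Real.norm_eq_abs, abs_of_nonneg (hs0 x)]
    rcases le_total ‖x‖ (R + 1) with hx | hx
    · exact (mul_le_of_le_one_left (norm_nonneg _) (hs1 x)).trans (hB x hx)
    · rw [hsout x hx, zero_mul]
      exact B.2
  · intro x hx
    have hx' : ‖x‖ ≤ R := by simpa using hx
    simp only [hsin x hx', one_smul]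
    exact hFG hx

/-- Continuity argument: a bound `‖c‖ ≤ r` that holds as long as `‖c‖ < R`, with `r < R`, holds
for all times. -/
theorem norm_le_of_trapped {F : Type*} [NormedAddCommGroup F] {c : ℝ → F} {T r R : ℝ} (hrR : r < R) (hc : ContinuousOn c (Ico 0 T))
    (h0 : ‖c 0‖ < R)
    (h : ∀ T' ≤ T, (∀ t ∈ Ico 0 T', ‖c t‖ < R) → ∀ t ∈ Ico 0 T', ‖c t‖ ≤ r) :
    ∀ t ∈ Ico 0 T, ‖c t‖ ≤ r := by
  refine h T le_rfl ?_
  by_contra! hcon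
  obtain ⟨t₁, ht₁, hR⟩ := hcon
  have hsub : Icc 0 t₁ ⊆ Ico 0 T := fun t ht => ⟨ht.1, ht.2.trans_lt ht₁.2⟩
  have hcn : ContinuousOn (fun t => ‖c t‖) (Icc 0 t₁) := (hc.mono hsub).norm
  -- At the first time `τ` in `S` the bound `r` holds before `τ`, hence at `τ` by continuity,
  -- against `r < R`.
  set S : Set ℝ := Icc 0 t₁ ∩ (fun t => ‖c t‖) ⁻¹' Ici R with hS
  have hScl : IsClosed S := hcn.preimage_isClosed_of_isClosed isClosed_Icc isClosed_Ici
  have hSne : S.Nonempty := ⟨t₁, ⟨ht₁.1, le_rfl⟩, hR⟩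
  have hSbdd : BddBelow S := ⟨0, fun t ht => ht.1.1⟩
  set τ := sInf S
  have hτ : τ ∈ S := hScl.csInf_mem hSne hSbdd
  have hτpos : 0 < τ := by
    rcases hτ.1.1.lt_or_eq with h | h
    · exact h
    · have : R ≤ ‖c τ‖ := hτ.2
      rw [← h] at this
      exact absurd h0 (not_lt.2 this)
  have hlt : ∀ t ∈ Ico 0 τ, ‖c t‖ < R := by
    intro t ht
    by_contra! hge
    exact absurd (csInf_le hSbdd (show t ∈ S from ⟨⟨ht.1, ht.2.le.trans hτ.1.2⟩, hge⟩))
      (not_le.2 ht.2)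
  have hle := h τ (hτ.1.2.trans ht₁.2.le) hlt
  have hlim : ‖c τ‖ ≤ r := by
    have hmem : τ ∈ closure (Ico 0 τ) := by
      rw [closure_Ico hτpos.ne]
      exact ⟨hτpos.le, le_rfl⟩
    have hcw : ContinuousWithinAt (fun t => ‖c t‖) (Ico 0 τ) τ :=
      (hcn τ hτ.1).mono fun t ht => ⟨ht.1, ht.2.le.trans hτ.1.2⟩
    exact hcw.closure_le hmem continuousWithinAt_const hle
  exact absurd (hlim.trans_lt hrR) (not_lt.2 hτ.2)

/-- A field that is Lipschitz on a ball has a solution for all nonnegative times from every point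
whose solutions obey an a priori bound inside the ball. -/
theorem exists_solution_Ici_of_apriori_bound [FiniteDimensional ℝ E] {F : E → E} {K : NNReal}
    {r R : ℝ} (hrR : r < R) (hF : LipschitzOnWith K F (Metric.closedBall 0 R)) {x₀ : E}
    (hx₀ : ‖x₀‖ ≤ r)
    (h : ∀ (c : ℝ → E) (T : ℝ), IsSolutionOn F (Metric.ball 0 R) c (Ico 0 T) → c 0 = x₀ →
      ∀ t ∈ Ico 0 T, ‖c t‖ ≤ r) :
    ∃ c : ℝ → E, c 0 = x₀ ∧ IsSolutionOn F (Metric.closedBall 0 r) c (Ici 0) := by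
  have : CompleteSpace E := FiniteDimensional.complete ℝ E
  have hR : 0 ≤ R := (norm_nonneg x₀).trans (hx₀.trans hrR.le)
  obtain ⟨G, K', B, hG, hB, hFG⟩ := exists_bounded_lipschitz_eqOn_closedBall hR hF
  obtain ⟨c, h0, hc⟩ := exists_solution_Ici_of_lipschitz_of_bounded hG hB x₀
  -- While the solution of the modified field stays inside radius `R` it solves the original
  -- equation, so the a priori bound applies and traps it.
  have hbound : ∀ t ∈ Ici (0 : ℝ), ‖c t‖ ≤ r := by
    intro t ht
    refine norm_le_of_trapped (T := t + 1) hrR (hc.continuousOn.mono Ico_subset_Ici_self)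
      (h0 ▸ hx₀.trans_lt hrR) (fun T' _ hlt => ?_) t ⟨ht, by linarith⟩
    refine h c T' (fun s hs => ⟨by simpa using hlt s hs, ?_⟩) h0
    rw [hFG (by simpa using (hlt s hs).le)]
    exact (hc s hs.1).2.mono Ico_subset_Ici_self
  refine ⟨c, h0, fun t ht => ⟨by simpa using hbound t ht, ?_⟩⟩
  rw [hFG (by simpa using (hbound t ht).trans hrR.le)]
  exact (hc t ht).2

/-! ### Decay under exponentially small perturbations -/

theorem gronwallBound_zero_left (K ε x : ℝ) :
    gronwallBound 0 K ε x = ε * gronwallBound 0 K 1 x := by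
  unfold gronwallBound
  split_ifs <;> ring

/-- A curve that solves an exponentially stable Lipschitz equation up to an exponentially decaying
error decays exponentially. -/
theorem exp_decay_of_approx_solution {w : E → E} {S S₀ : Set E} {K : NNReal} {M lam κ L : ℝ}
    (hw : LipschitzOnWith K w S) (hS₀ : S₀ ⊆ S) (hM : 0 < M) (hlam : 0 < lam)
    (hφ : ∀ x ∈ S₀, ∃ φ : ℝ → E, φ 0 = x ∧ IsSolutionOn w S φ (Ici 0) ∧
      ∀ t, 0 ≤ t → ‖φ t‖ ≤ M * Real.exp (-lam * t) * ‖x‖)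
    (hκ : 0 < κ) (hL : 0 ≤ L) :
    ∃ B > 0, ∃ μ > 0, μ ≤ κ ∧ ∀ (z z' : ℝ → E) (T P : ℝ), 0 ≤ P →
      (∀ t ∈ Ico 0 T, z t ∈ S₀) → (∀ t ∈ Ico 0 T, HasDerivWithinAt z (z' t) (Ico 0 T) t) →
      (∀ t ∈ Ico 0 T, ‖z' t - w (z t)‖ ≤ L * Real.exp (-κ * t) * P) → ‖z 0‖ ≤ P →
      ∀ t ∈ Ico 0 T, ‖z t‖ ≤ B * Real.exp (-μ * t) * P := by
  obtain ⟨τ, hτ, hMτ⟩ : ∃ τ : ℝ, 0 < τ ∧ M * Real.exp (-lam * τ) ≤ 1 / 2 := by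
    have h1 : Tendsto (fun τ : ℝ => M * Real.exp (-lam * τ)) atTop (𝓝 (M * 0)) := by
      refine Tendsto.const_mul _ (Real.tendsto_exp_atBot.comp ?_)
      exact tendsto_id.const_mul_atTop_of_neg (by linarith)
    rw [mul_zero] at h1
    have h2 := (h1.eventually (gt_mem_nhds (show (0 : ℝ) < 1 / 2 by norm_num))).and
      (eventually_gt_atTop 0)
    obtain ⟨τ, h, h'⟩ := h2.exists
    exact ⟨τ, h', h.le⟩
  -- Largest deviation accumulated over one window, per unit of `exp (-κ a) P` at its left end `a`.
  set G : ℝ := L * gronwallBound 0 K 1 τ with hGdef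
  have hmono := gronwallBound_mono (δ := 0) (K := K) (ε := 1) le_rfl zero_le_one K.2
  have hG : 0 ≤ G := by
    refine mul_nonneg hL ?_
    have := hmono hτ.le
    rwa [gronwallBound_x0] at this
  obtain ⟨μ, hμ, hμκ, hμτ⟩ : ∃ μ : ℝ, 0 < μ ∧ μ ≤ κ ∧ Real.exp (μ * τ) ≤ 4 / 3 := by
    refine ⟨min κ (Real.log (4 / 3) / τ), lt_min hκ (div_pos (Real.log_pos (by norm_num)) hτ),
      min_le_left _ _, ?_⟩
    rw [← Real.le_log_iff_exp_le (by norm_num), ← le_div_iff₀ hτ]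
    exact min_le_right _ _
  -- The induction closes because `(4 (M + G) / 2 + G) * (4 / 3) ≤ 4 (M + G)`; the factor `4 / 3` is
  -- the cost of shifting time by `τ` at rate `μ`.
  refine ⟨4 * (M + G), by positivity, μ, hμ, hμκ, ?_⟩
  intro z z' T P hP hz hz' happ hz0
  -- Gronwall against the exact solution restarted at `z a`, with initial distance 0. That solution
  -- need only stay in the larger set `S`.
  have hwindow : ∀ a s : ℝ, 0 ≤ a → 0 ≤ s → s ≤ τ → a + s < T →
      ‖z (a + s)‖ ≤ M * Real.exp (-lam * s) * ‖z a‖ + G * Real.exp (-κ * a) * P := by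
    intro a s ha hs hsτ haT
    have haI : a ∈ Ico 0 T := ⟨ha, by linarith⟩
    obtain ⟨φ, hφ0, hφs, hφd⟩ := hφ (z a) (hz a haI)
    have hzr : ∀ t ∈ Ico 0 T, HasDerivWithinAt z (z' t) (Ici t) t := fun t ht =>
      ((hz' t ht).mono (Ico_subset_Ico_left ht.1)).mono_of_mem_nhdsWithin (Ico_mem_nhdsGE ht.2)
    have hsub : Icc a (a + s) ⊆ Ico 0 T := fun t ht => ⟨ha.trans ht.1, ht.2.trans_lt haT⟩
    have hgder : ∀ t, a ≤ t →
        HasDerivWithinAt (fun t => φ (t - a)) (w (φ (t - a))) (Ici t) t := by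
      intro t hat
      have h1 := (hφs (t - a) (sub_nonneg.2 hat)).2
      have h2 : HasDerivWithinAt (fun t : ℝ => t - a) 1 (Ici t) t :=
        ((hasDerivAt_id t).sub_const a).hasDerivWithinAt
      have h3 := h1.scomp t h2 (fun x hx => sub_nonneg.2 (hat.trans hx))
      simpa using! h3
    have hgr := dist_le_of_approx_trajectories_ODE_of_mem (v := fun _ => w) (s := fun _ => S)
      (K := K) (f := z) (g := fun t => φ (t - a)) (f' := z') (g' := fun t => w (φ (t - a)))
      (a := a) (b := a + s) (εf := L * Real.exp (-κ * a) * P) (εg := 0) (δ := 0)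
      (fun _ _ => hw) (fun t ht => ((hz' t (hsub ht)).continuousWithinAt).mono hsub)
      (fun t ht => hzr t (hsub (Ico_subset_Icc_self ht)))
      (fun t ht => by
        rw [dist_eq_norm]
        refine (happ t (hsub (Ico_subset_Icc_self ht))).trans ?_
        have : -κ * t ≤ -κ * a := by nlinarith [ht.1]
        gcongr)
      (fun t ht => hS₀ (hz t (hsub (Ico_subset_Icc_self ht))))
      (hφs.continuousOn.comp (by fun_prop) (fun x hx => sub_nonneg.2 hx.1))
      (fun t ht => hgder t ht.1) (fun t ht => by simp)
      (fun t ht => (hφs (t - a) (sub_nonneg.2 ht.1)).1)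
      (by simp [hφ0]) (a + s) ⟨by linarith, le_rfl⟩
    rw [add_zero, add_sub_cancel_left, dist_eq_norm, gronwallBound_zero_left] at hgr
    have hφb := hφd s hs
    have h4 : ‖z (a + s)‖ ≤ ‖φ s‖ + ‖z (a + s) - φ s‖ := by
      simpa using norm_add_le (φ s) (z (a + s) - φ s)
    have h5 : L * Real.exp (-κ * a) * P * gronwallBound 0 K 1 s ≤ G * Real.exp (-κ * a) * P := by
      have : gronwallBound 0 K 1 s ≤ gronwallBound 0 K 1 τ := hmono hsτ
      calc L * Real.exp (-κ * a) * P * gronwallBound 0 K 1 s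
          ≤ L * Real.exp (-κ * a) * P * gronwallBound 0 K 1 τ := by gcongr
        _ = G * Real.exp (-κ * a) * P := by rw [hGdef]; ring
    linarith
  have hind : ∀ n : ℕ, ∀ t ∈ Ico 0 T, t ≤ (n + 1) * τ →
      ‖z t‖ ≤ 4 * (M + G) * Real.exp (-μ * t) * P := by
    have hback : ∀ t, Real.exp (-μ * (t - τ)) ≤ 4 / 3 * Real.exp (-μ * t) := by
      intro t
      rw [show -μ * (t - τ) = μ * τ + -μ * t by ring, Real.exp_add]
      gcongr
    intro n
    induction n with
    | zero =>
      intro t ht htτ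
      have h1 := hwindow 0 t le_rfl ht.1 (by simpa using htτ) (by simpa using ht.2)
      simp only [zero_add, mul_zero, Real.exp_zero, mul_one] at h1
      have h2 : Real.exp (-lam * t) ≤ 1 := Real.exp_le_one_iff.2 (by nlinarith [ht.1])
      have h3 : M * Real.exp (-lam * t) * ‖z 0‖ ≤ M * 1 * P := by gcongr
      have h4 : 1 ≤ Real.exp (-μ * (t - τ)) :=
        Real.one_le_exp (by simp only [Nat.cast_zero, zero_add, one_mul] at htτ; nlinarith)
      have h5 := h4.trans (hback t)
      have h6 : (M + G) * P ≤ (M + G) * P * (4 / 3 * Real.exp (-μ * t)) :=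
        le_mul_of_one_le_right (by positivity) h5
      have h7 : 0 ≤ (M + G) * P * Real.exp (-μ * t) := by positivity
      linarith
    | succ n ih =>
      intro t ht htτ
      rcases le_total t ((n + 1) * τ) with h | h
      · exact ih t ht h
      · have hn : 0 ≤ (n : ℝ) * τ := by positivity
        have hat : 0 ≤ t - τ := by linarith
        have h0 := ih (t - τ) ⟨hat, by linarith [ht.2]⟩ (by push_cast at htτ; linarith)
        have h1 := hwindow (t - τ) τ hat hτ.le le_rfl (by simpa using ht.2)
        rw [sub_add_cancel] at h1
        have h2 : M * Real.exp (-lam * τ) * ‖z (t - τ)‖ ≤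
            1 / 2 * (4 * (M + G) * Real.exp (-μ * (t - τ)) * P) := by gcongr
        have h3 : Real.exp (-κ * (t - τ)) ≤ Real.exp (-μ * (t - τ)) :=
          Real.exp_le_exp.2 (by nlinarith)
        have h4 : G * Real.exp (-κ * (t - τ)) * P ≤ G * Real.exp (-μ * (t - τ)) * P := by gcongr
        have h5 : (2 * M + 3 * G) * P * Real.exp (-μ * (t - τ)) ≤
            (2 * M + 3 * G) * P * (4 / 3 * Real.exp (-μ * t)) :=
          mul_le_mul_of_nonneg_left (hback t) (by positivity)
        have h6 : 0 ≤ M * P * Real.exp (-μ * t) := by positivity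
        linarith
  intro t ht
  obtain ⟨n, hn⟩ := exists_nat_ge (t / τ)
  refine hind n t ht ?_
  rw [div_le_iff₀ hτ] at hn
  linarith

/-! ### From decay bounds to decaying solutions -/

/-- A priori exponential bounds give exponentially decaying solutions for all nonnegative times. -/
theorem exists_decaying_solution [FiniteDimensional ℝ E] {F : E → E} {X D : Set E} {M lam R : ℝ}
    {K : NNReal} (hlam : 0 < lam)
    (h : ∀ (c : ℝ → E) (T : ℝ), IsSolutionOn F X c (Ico 0 T) → c 0 ∈ D →
      ∀ t ∈ Ico 0 T, ‖c t‖ ≤ M * Real.exp (-lam * t) * ‖c 0‖) (hM : 0 < M)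
    (hX : Metric.ball 0 R ⊆ X) (hF : LipschitzOnWith K F (Metric.closedBall 0 R)) {x₀ : E}
    (hx₀ : x₀ ∈ D) (hR : ‖x₀‖ < R) (hMR : M * ‖x₀‖ < R) :
    ∃ c : ℝ → E, c 0 = x₀ ∧ IsSolutionOn F (Metric.ball 0 R) c (Ici 0) ∧
      ∀ t, 0 ≤ t → ‖c t‖ ≤ M * Real.exp (-lam * t) * ‖x₀‖ := by
  -- The maximum is needed because `M ≥ 1` is not assumed.
  have hr : max (M * ‖x₀‖) ‖x₀‖ < R := max_lt hMR hR
  obtain ⟨c, h0, hc⟩ := exists_solution_Ici_of_apriori_bound hr hF (le_max_right _ _) (by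
    intro c T hc h0 t ht
    have h1 := h c T (hc.mono hX subset_rfl) (h0 ▸ hx₀) t ht
    rw [h0] at h1
    refine h1.trans (le_trans ?_ (le_max_left _ _))
    have h2 : Real.exp (-lam * t) ≤ 1 := Real.exp_le_one_iff.2 (by nlinarith [ht.1])
    rw [mul_right_comm]
    exact mul_le_of_le_one_right (by positivity) h2)
  have hc' : IsSolutionOn F (Metric.ball 0 R) c (Ici 0) :=
    hc.mono (Metric.closedBall_subset_ball hr) subset_rfl
  refine ⟨c, h0, hc', fun t ht => ?_⟩
  have := h c (t + 1) (hc'.mono hX Ico_subset_Ici_self) (h0 ▸ hx₀) t ⟨ht, by linarith⟩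
  rwa [h0] at this

/-- The decay bound confines solutions from `x₀` to a compact ball, where a single Lipschitz
constant is available. -/
theorem ExpStableOn.forwardCompleteOn_univ [FiniteDimensional ℝ E] {F : E → E}
    (h : ExpStableOn F univ univ) (hF : LocallyLipschitz F) : ForwardCompleteOn F univ univ := by
  obtain ⟨M, hM, lam, hlam, h⟩ := h
  intro x₀ _
  have : ProperSpace E := FiniteDimensional.proper ℝ E
  obtain ⟨K, hK⟩ := (hF.locallyLipschitzOn (s := Metric.closedBall 0 ((M + 1) * ‖x₀‖ + 1))
    ).exists_lipschitzOnWith_of_compact (isCompact_closedBall _ _)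
  have h1 : 0 ≤ M * ‖x₀‖ := by positivity
  obtain ⟨c, h0, hc, -⟩ := exists_decaying_solution hlam h hM (subset_univ _) hK (mem_univ x₀)
    (by linarith) (by linarith [norm_nonneg x₀])
  exact ⟨c, h0, hc.mono (subset_univ _) subset_rfl⟩

/-- Exponential stability inside a ball gives exponential stability on a neighbourhood. -/
theorem ExpStableOn.exists_ball [FiniteDimensional ℝ E] {F : E → E} {X : Set E} {δ : ℝ}
    (hδ : 0 < δ) (h : ExpStableOn F (Metric.ball 0 δ) univ) (hX : Metric.closedBall 0 δ ⊆ X) :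
    ∃ δ₀ > 0, ExpStableOn F X (Metric.ball 0 δ₀) ∧
      ((∃ K, LipschitzOnWith K F (Metric.closedBall 0 δ)) →
        ForwardCompleteOn F X (Metric.ball 0 δ₀)) := by
  obtain ⟨M, hM, lam, hlam, h⟩ := h
  have hδ₀ : 0 < δ / (2 * (M + 1)) := by positivity
  have hsmall : ∀ x : E, ‖x‖ < δ / (2 * (M + 1)) → ‖x‖ < δ ∧ M * ‖x‖ ≤ δ / 2 := by
    intro x hx
    rw [lt_div_iff₀ (by positivity)] at hx
    have h1 : 0 ≤ M * ‖x‖ := by positivity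
    constructor <;> linarith [norm_nonneg x]
  refine ⟨_, hδ₀, ⟨M, hM, lam, hlam, fun c T hc h0 t ht => ?_⟩, fun ⟨K, hK⟩ x₀ hx₀ => ?_⟩
  · have hs := hsmall (c 0) (by simpa using h0)
    -- A solution in `X` might leave the ball of radius `δ`, where no decay is known; the small
    -- initial value traps it in half that radius.
    have hb : ∀ t ∈ Ico 0 T, ‖c t‖ ≤ δ / 2 := by
      refine norm_le_of_trapped (half_lt_self hδ) hc.continuousOn hs.1 fun T' hT' hlt s hs' => ?_
      have h1 := h c T' (fun s hs => ⟨by simpa using hlt s hs,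
        (hc s ⟨hs.1, hs.2.trans_le hT'⟩).2.mono (Ico_subset_Ico_right hT')⟩) (mem_univ _) s hs'
      refine h1.trans (le_trans ?_ hs.2)
      have h2 : Real.exp (-lam * s) ≤ 1 := Real.exp_le_one_iff.2 (by nlinarith [hs'.1])
      rw [mul_right_comm]
      exact mul_le_of_le_one_right (by positivity) h2
    exact h c T (fun s hs => ⟨by simpa using (hb s hs).trans_lt (half_lt_self hδ), (hc s hs).2⟩)
      (mem_univ _) t ht
  · have hs := hsmall x₀ (by simpa using hx₀)
    obtain ⟨c, h0, hc, -⟩ := exists_decaying_solution hlam h hM subset_rfl hK (mem_univ x₀)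
      hs.1 (by linarith)
    exact ⟨c, h0, hc.mono (Metric.ball_subset_closedBall.trans hX) subset_rfl⟩

/-! ### Bi-Lipschitz maps and directional invariance -/

variable {F : Type*} [NormedAddCommGroup F] [NormedSpace ℝ F]

/-- An injective strict derivative makes the map bi-Lipschitz near the point. -/
theorem _root_.HasStrictFDerivAt.exists_norm_sub_le [FiniteDimensional ℝ E] {f : E → F}
    {f' : E →L[ℝ] F} {a : E} (hf : HasStrictFDerivAt f f' a) (hf' : ∀ v, f' v = 0 → v = 0) :
    ∃ C > 0, ∃ s ∈ 𝓝 a, ∀ x ∈ s, ∀ y ∈ s,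
      ‖x - y‖ ≤ C * ‖f x - f y‖ ∧ ‖f x - f y‖ ≤ C * ‖x - y‖ := by
  obtain ⟨K, hK, hanti⟩ := LinearMap.exists_antilipschitzWith (f' : E →ₗ[ℝ] F)
    (LinearMap.ker_eq_bot'.2 hf')
  have hK' : (0 : ℝ) < K := hK
  obtain ⟨K₂, t, ht, hlip⟩ := hf.exists_lipschitzOnWith
  -- With this accuracy the linearization error costs only half of `‖x - y‖`, which is absorbed on
  -- the left.
  obtain ⟨s, hs, happ⟩ := hf.approximates_deriv_on_nhds (c := (2 * K)⁻¹) (Or.inr (by positivity))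
  refine ⟨2 * K + K₂, by positivity, s ∩ t, inter_mem hs ht, fun x hx y hy => ⟨?_, ?_⟩⟩
  · have h1 := happ x hx.1 y hy.1
    have h2 : ‖x - y‖ ≤ K * ‖f' (x - y)‖ := by
      simpa [dist_eq_norm] using hanti.le_mul_dist (x - y) 0
    have h3 : ‖f' (x - y)‖ ≤ ‖f x - f y‖ + ‖f x - f y - f' (x - y)‖ := by
      simpa using norm_sub_le (f x - f y) (f x - f y - f' (x - y))
    have h4 : (K : ℝ) * ‖f' (x - y)‖ ≤ K * (‖f x - f y‖ + (2 * (K : ℝ))⁻¹ * ‖x - y‖) := by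
      gcongr
      refine h3.trans (add_le_add_right (h1.trans_eq ?_) _)
      simp
    have h5 : (K : ℝ) * (‖f x - f y‖ + (2 * (K : ℝ))⁻¹ * ‖x - y‖) =
        K * ‖f x - f y‖ + ‖x - y‖ / 2 := by
      field_simp
    have h6 : 0 ≤ (K₂ : ℝ) * ‖f x - f y‖ := by positivity
    linarith
  · have h1 := hlip.dist_le_mul x hx.2 y hy.2
    rw [dist_eq_norm, dist_eq_norm] at h1
    have h2 : 0 ≤ 2 * (K : ℝ) * ‖x - y‖ := by positivity
    linarith

/-- A function with vanishing derivative in the direction `v` is locally invariant along `v`. -/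
theorem eventually_eq_add_smul_of_fderiv_apply_eq_zero {h : E → F} {X : Set E} {v x : E}
    (hX : IsOpen X) (hh : DifferentiableOn ℝ h X) (hv : ∀ x ∈ X, fderiv ℝ h x v = 0)
    (hx : x ∈ X) : ∀ᶠ s : ℝ in 𝓝 0, ∀ᶠ ξ in 𝓝 x, h (ξ + s • v) = h ξ := by
  obtain ⟨ε, hε, hball⟩ := Metric.isOpen_iff.1 hX x hx
  have hline : ∀ p q : E, p ∈ Metric.ball x ε → p + q ∈ Metric.ball x ε →
      (∃ s : ℝ, q = s • v) → h (p + q) = h p := by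
    rintro p q hp hpq ⟨s, rfl⟩
    have hseg : ∀ t ∈ Icc (0 : ℝ) 1, p + t • s • v ∈ X := fun t ht => hball <|
      (convex_ball x ε).add_smul_mem hp hpq ht
    have hder : ∀ t ∈ Icc (0 : ℝ) 1, HasDerivAt (fun t : ℝ => h (p + t • s • v)) 0 t := by
      intro t ht
      have h1 := ((hh _ (hseg t ht)).differentiableAt (hX.mem_nhds (hseg t ht))).hasFDerivAt
      have h2 : HasDerivAt (fun t : ℝ => p + t • s • v) (s • v) t := by
        simpa using ((hasDerivAt_id t).smul_const (s • v)).const_add p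
      have h3 := h1.comp_hasDerivAt t h2
      rwa [map_smul, hv _ (hseg t ht), smul_zero] at h3
    have := constant_of_has_deriv_right_zero (fun t ht => (hder t ht).continuousAt.continuousWithinAt)
      (fun t ht => (hder t (Ico_subset_Icc_self ht)).hasDerivWithinAt) 1 (by simp)
    simpa using this
  have hcont : Tendsto (fun q : ℝ × E => q.2 + q.1 • v) (𝓝 (0, x)) (𝓝 x) := by
    have : Continuous fun q : ℝ × E => q.2 + q.1 • v := by fun_prop
    simpa using this.tendsto (0, x)
  have hev : ∀ᶠ q : ℝ × E in 𝓝 0 ×ˢ 𝓝 x, h (q.2 + q.1 • v) = h q.2 := by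
    rw [← nhds_prod_eq]
    filter_upwards [hcont.eventually (Metric.ball_mem_nhds x hε),
      (continuous_snd.tendsto ((0 : ℝ), x)).eventually (Metric.ball_mem_nhds x hε)] with q h1 h2
    exact hline _ _ h2 h1 ⟨_, rfl⟩
  exact hev.curry

/-- If `∂_v h = 0` on `X` and the field changes by `s • u` along `s • v`, then
`∂_v (L_f h) = ∂_u h`. -/
theorem fderiv_lieDeriv_apply {f : E → E} {h : E → ℝ} {X : Set E} {u v x : E}
    (hX : IsOpen X) (hh : DifferentiableOn ℝ h X) (hv : ∀ x ∈ X, fderiv ℝ h x v = 0)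
    (hx : x ∈ X) (hf : ∀ᶠ s : ℝ in 𝓝 0, f (x + s • v) = f x + s • u)
    (hd : DifferentiableAt ℝ (lieDeriv f h) x) :
    fderiv ℝ (lieDeriv f h) x v = fderiv ℝ h x u := by
  have hline : HasDerivAt (fun s : ℝ => x + s • v) v 0 := by
    simpa using ((hasDerivAt_id (0 : ℝ)).smul_const v).const_add x
  have h1 : HasDerivAt (fun s : ℝ => lieDeriv f h (x + s • v)) (fderiv ℝ (lieDeriv f h) x v) 0 := by
    refine HasFDerivAt.comp_hasDerivAt (l := lieDeriv f h) (0 : ℝ) ?_ hline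
    simpa using hd.hasFDerivAt
  have h2 : HasDerivAt (fun s : ℝ => fderiv ℝ h x (f x + s • u)) (fderiv ℝ h x u) 0 := by
    refine (fderiv ℝ h x).hasFDerivAt.comp_hasDerivAt (0 : ℝ) ?_
    simpa using ((hasDerivAt_id (0 : ℝ)).smul_const u).const_add (f x)
  refine h1.unique (h2.congr_of_eventuallyEq ?_)
  filter_upwards [hf, eventually_eq_add_smul_of_fderiv_apply_eq_zero hX hh hv hx] with s hs hs'
  -- Since `h` is only differentiable, mixed second derivatives cannot be exchanged. Invariance of
  -- `h` on a whole neighbourhood makes its derivative invariant under the translation, so `L_f h`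
  -- is affine in `s` along the line.
  have h3 : fderiv ℝ h (x + s • v) = fderiv ℝ h x := by
    rw [← fderiv_comp_add_right]
    exact Filter.EventuallyEq.fderiv_eq hs'
  simp only [lieDeriv, h3, hs]

end General

/-! ### Triangular structure of the error coordinates -/

variable {γ m : ℕ}

theorem shift_add (η η' : Eu γ) : shift (η + η') = shift η + shift η' := by
  ext i
  simp only [shift, PiLp.add_apply]
  split_ifs <;> simp

theorem shift_smul (s : ℝ) (η : Eu γ) : shift (s • η) = s • shift η := by
  ext i
  simp only [shift, PiLp.smul_apply]
  split_ifs <;> simp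

theorem shift_single {i j : Fin γ} (hij : (i : ℕ) = j + 1) :
    shift (EuclideanSpace.single i (1 : ℝ)) = EuclideanSpace.single j 1 := by
  ext l
  simp only [shift, PiLp.single_apply, Fin.ext_iff, hij, add_left_inj]
  split_ifs with h1 h2 h2
  · rfl
  · rfl
  · exact absurd i.2 (by omega)
  · rfl

/-- The direction of the coordinate `η_i` in the state space. -/
noncomputable def etaDir (m : ℕ) {γ : ℕ} (i : Fin γ) : State γ m := (EuclideanSpace.single i (1 : ℝ), 0)

/-- The shift sends the `i`-th basis vector to the one before it, and `ω` does not see `η_i`. -/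
theorem eventually_drift_add_smul_etaDir {ω : State γ m → Eu m} {X : Set (State γ m)}
    (hX : IsOpen X) (hω : DifferentiableOn ℝ ω X) {i j : Fin γ} (hij : (i : ℕ) = j + 1)
    (hωi : ∀ ζ ∈ X, fderiv ℝ ω ζ (etaDir m i) = 0) {ζ : State γ m} (hζ : ζ ∈ X) :
    ∀ᶠ s : ℝ in 𝓝 0, drift ω (ζ + s • etaDir m i) = drift ω ζ + s • etaDir m j := by
  filter_upwards [eventually_eq_add_smul_of_fderiv_apply_eq_zero hX hω hωi hζ] with s hs
  refine Prod.ext ?_ ?_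
  · simp only [drift, etaDir, Prod.fst_add, Prod.smul_fst, shift_add, shift_smul,
      shift_single hij]
  · simp only [drift, Prod.snd_add, Prod.smul_snd, hs.self_of_nhds]
    simp [etaDir]

/-- The output is affine along the `η`-directions, so `ψ` itself is never differentiated. -/
theorem fderiv_output_apply [NeZero γ] {ψ : Eu m → Eu γ} {ζ : State γ m}
    (hd : DifferentiableAt ℝ (output ψ) ζ) (w : Eu γ) :
    fderiv ℝ (output ψ) ζ (w, 0) = w 0 := by
  have hline : HasDerivAt (fun s : ℝ => ζ + s • ((w, 0) : State γ m)) (w, 0) 0 := by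
    simpa using ((hasDerivAt_id (0 : ℝ)).smul_const ((w, 0) : State γ m)).const_add ζ
  have h1 : HasDerivAt (fun s : ℝ => output ψ (ζ + s • ((w, 0) : State γ m)))
      (fderiv ℝ (output ψ) ζ (w, 0)) 0 := by
    refine HasFDerivAt.comp_hasDerivAt (l := output ψ) (0 : ℝ) ?_ hline
    simpa using hd.hasFDerivAt
  have h2 : HasDerivAt (fun s : ℝ => output ψ ζ + s * w 0) (w 0) 0 := by
    simpa using ((hasDerivAt_id (0 : ℝ)).mul_const (w 0)).const_add (output ψ ζ)
  refine h1.unique (h2.congr_of_eventuallyEq (Eventually.of_forall fun s => ?_))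
  simp [output]
  ring

theorem inputField_eq_etaDir (hγ : γ - 1 < γ) (ζ : State γ m) :
    inputField γ m ζ = etaDir m ⟨γ - 1, hγ⟩ := by
  refine Prod.ext ?_ rfl
  ext i
  simp only [inputField, etaDir, PiLp.single_apply, Fin.ext_iff]
  congr 1
  exact propext ⟨fun h => by omega, fun h => by omega⟩

section Triangular

variable [NeZero γ] {ω : State γ m → Eu m} {ψ : Eu m → Eu γ} {X : Set (State γ m)}

/-- The step from `L_f^j y` to `L_f^(j+1) y` in the directions `η_i`. -/
theorem fderiv_lieDeriv_iterate_succ (hX : IsOpen X) (hω : DifferentiableOn ℝ ω X)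
    (hω3 : ∀ i : Fin γ, 2 ≤ (i : ℕ) → ∀ ζ ∈ X, fderiv ℝ ω ζ (etaDir m i) = 0)
    (hy : ∀ k < γ, DifferentiableOn ℝ ((lieDeriv (drift ω))^[k] (output ψ)) X)
    {j : ℕ} (hj : j + 1 < γ) {i i' : Fin γ} (hi : 2 ≤ (i : ℕ)) (hii' : (i : ℕ) = i' + 1)
    (hv : ∀ ζ ∈ X, fderiv ℝ ((lieDeriv (drift ω))^[j] (output ψ)) ζ (etaDir m i) = 0)
    {ζ : State γ m} (hζ : ζ ∈ X) :
    fderiv ℝ ((lieDeriv (drift ω))^[j + 1] (output ψ)) ζ (etaDir m i) =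
      fderiv ℝ ((lieDeriv (drift ω))^[j] (output ψ)) ζ (etaDir m i') := by
  have hd := (hy (j + 1) hj ζ hζ).differentiableAt (hX.mem_nhds hζ)
  rw [Function.iterate_succ_apply'] at hd ⊢
  exact fderiv_lieDeriv_apply hX (hy j (by omega)) hv hζ
    (eventually_drift_add_smul_etaDir hX hω hii' (hω3 i hi) hζ) hd

/-- `L_f^j y` does not depend on `η_i` for `i > j`. -/
theorem fderiv_lieDeriv_iterate_eq_zero (hX : IsOpen X) (hω : DifferentiableOn ℝ ω X)
    (hω3 : ∀ i : Fin γ, 2 ≤ (i : ℕ) → ∀ ζ ∈ X, fderiv ℝ ω ζ (etaDir m i) = 0)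
    (hy : ∀ k < γ, DifferentiableOn ℝ ((lieDeriv (drift ω))^[k] (output ψ)) X)
    (j : ℕ) (i : Fin γ) (hij : j < i) :
    ∀ ζ ∈ X, fderiv ℝ ((lieDeriv (drift ω))^[j] (output ψ)) ζ (etaDir m i) = 0 := by
  induction j generalizing i with
  | zero =>
    intro ζ hζ
    have hd := (hy 0 (NeZero.pos γ) ζ hζ).differentiableAt (hX.mem_nhds hζ)
    rw [Function.iterate_zero_apply] at hd ⊢
    rw [etaDir, fderiv_output_apply hd]
    have : (0 : Fin γ) ≠ i := fun h => by
      rw [← h] at hij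
      simp at hij
    simp [this]
  | succ j ih =>
    intro ζ hζ
    have hi' : (i : ℕ) - 1 < γ := by omega
    rw [fderiv_lieDeriv_iterate_succ hX hω hω3 hy (by omega) (i' := ⟨i - 1, hi'⟩) (by omega)
      (by simp only; omega) (ih i (by omega)) hζ]
    exact ih ⟨i - 1, hi'⟩ (by simp only; omega) ζ hζ

/-- The diagonal entries `∂(L_f^j y)/∂η_(j+1)` do not vanish where `L_g L_f^(γ-1) y` does not. -/
theorem fderiv_lieDeriv_iterate_diag_ne_zero (hX : IsOpen X) (hω : DifferentiableOn ℝ ω X)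
    (hω3 : ∀ i : Fin γ, 2 ≤ (i : ℕ) → ∀ ζ ∈ X, fderiv ℝ ω ζ (etaDir m i) = 0)
    (hy : ∀ k < γ, DifferentiableOn ℝ ((lieDeriv (drift ω))^[k] (output ψ)) X)
    {ζ : State γ m} (hζ : ζ ∈ X)
    (hne : lieDeriv (inputField γ m) ((lieDeriv (drift ω))^[γ - 1] (output ψ)) ζ ≠ 0)
    (j : Fin γ) :
    fderiv ℝ ((lieDeriv (drift ω))^[(j : ℕ)] (output ψ)) ζ (etaDir m j) ≠ 0 := by
  have hγ : γ - 1 < γ := Nat.sub_lt (NeZero.pos γ) one_pos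
  -- Entry 0 is separate: passing from entry 0 to entry 1 would need `ω` independent of `η₂`, which
  -- is not assumed.
  rcases Nat.eq_zero_or_pos (j : ℕ) with h0 | hpos
  · have hd := (hy 0 (NeZero.pos γ) ζ hζ).differentiableAt (hX.mem_nhds hζ)
    have hj : j = 0 := Fin.ext (by simpa using h0)
    subst hj
    rw [h0, Function.iterate_zero_apply] at *
    rw [etaDir, fderiv_output_apply hd]
    simp
  -- Consecutive entries are equal, so nonvanishing descends from the last one, `L_g L_f^(γ-1) y`;
  -- `d` is the distance to it.
  · have hind : ∀ d : ℕ, ∀ j : Fin γ, 1 ≤ (j : ℕ) → (j : ℕ) + d = γ - 1 →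
        fderiv ℝ ((lieDeriv (drift ω))^[(j : ℕ)] (output ψ)) ζ (etaDir m j) ≠ 0 := by
      intro d
      induction d with
      | zero =>
        intro j _ hj
        have hj' : j = ⟨γ - 1, hγ⟩ := Fin.ext (by simpa using hj)
        subst hj'
        rw [← inputField_eq_etaDir hγ ζ]
        exact hne
      | succ d ih =>
        intro j hj hjd
        have hj1 : (j : ℕ) + 1 < γ := by omega
        have h1 := ih ⟨j + 1, hj1⟩ (by simp) (by simp only; omega)
        rwa [fderiv_lieDeriv_iterate_succ hX hω hω3 hy hj1 (i' := j) (by simp only; omega)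
          rfl (fderiv_lieDeriv_iterate_eq_zero hX hω hω3 hy j _ (by simp)) hζ] at h1
    exact hind (γ - 1 - j) j hpos (by omega)

theorem contDiffOn_error
    (hy : ∀ k < γ, ContDiffOn ℝ 1 ((lieDeriv (drift ω))^[k] (output ψ)) X) :
    ContDiffOn ℝ 1 (error ω ψ) X := by
  rw [contDiffOn_euclidean]
  exact fun i => hy i i.2

/-- Forward substitution in a lower triangular system with nonzero diagonal. -/
theorem eq_zero_of_fderiv_error_apply_eq_zero (hX : IsOpen X) (hω : DifferentiableOn ℝ ω X)
    (hω3 : ∀ i : Fin γ, 2 ≤ (i : ℕ) → ∀ ζ ∈ X, fderiv ℝ ω ζ (etaDir m i) = 0)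
    (hy : ∀ k < γ, ContDiffOn ℝ 1 ((lieDeriv (drift ω))^[k] (output ψ)) X)
    {ζ : State γ m} (hζ : ζ ∈ X)
    (hne : lieDeriv (inputField γ m) ((lieDeriv (drift ω))^[γ - 1] (output ψ)) ζ ≠ 0)
    {w : Eu γ} (hw : fderiv ℝ (error ω ψ) ζ (w, 0) = 0) : w = 0 := by
  have hyd : ∀ k < γ, DifferentiableOn ℝ ((lieDeriv (drift ω))^[k] (output ψ)) X :=
    fun k hk => (hy k hk).differentiableOn one_ne_zero
  have hed : DifferentiableAt ℝ (error ω ψ) ζ :=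
    ((contDiffOn_error hy).differentiableOn one_ne_zero ζ hζ).differentiableAt (hX.mem_nhds hζ)
  have hcomp : ∀ (j : Fin γ) (v : State γ m),
      fderiv ℝ ((lieDeriv (drift ω))^[(j : ℕ)] (output ψ)) ζ v = fderiv ℝ (error ω ψ) ζ v j := by
    intro j v
    have h1 : HasFDerivAt ((lieDeriv (drift ω))^[(j : ℕ)] (output ψ)) _ ζ :=
      (EuclideanSpace.proj j : Eu γ →L[ℝ] ℝ).hasFDerivAt.comp ζ hed.hasFDerivAt
    rw [h1.fderiv]
    rfl
  have hsum : ∀ j : Fin γ, ∑ i, w i *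
      fderiv ℝ ((lieDeriv (drift ω))^[(j : ℕ)] (output ψ)) ζ (etaDir m i) = 0 := by
    intro j
    have h1 : ((w, 0) : State γ m) = ∑ i, w i • etaDir m i := by
      refine Prod.ext ?_ ?_
      · rw [Prod.fst_sum]
        ext l
        simp [etaDir, Pi.single_apply]
      · rw [Prod.snd_sum]
        simp [etaDir]
    have h2 := hcomp j (w, 0)
    rw [hw, h1, map_sum] at h2
    simpa using h2
  have hall : ∀ n : ℕ, ∀ j : Fin γ, (j : ℕ) = n → w j = 0 := by
    intro n
    induction n using Nat.strong_induction_on with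
    | _ n ih =>
      rintro j rfl
      have h1 := hsum j
      rw [Finset.sum_eq_single j] at h1
      · exact (mul_eq_zero.1 h1).resolve_right
          (fderiv_lieDeriv_iterate_diag_ne_zero hX hω hω3 hyd hζ hne j)
      · intro i _ hij
        rcases lt_or_gt_of_ne hij with h | h
        · rw [ih i h i rfl, zero_mul]
        · rw [fderiv_lieDeriv_iterate_eq_zero hX hω hω3 hyd j i h ζ hζ, mul_zero]
      · simp
  ext j
  exact hall j j rfl

/-- `(η, z) ↦ (e, z)` is bi-Lipschitz near a point where `y` has relative degree `γ`. -/
theorem exists_errorCoord_biLipschitz (hX : IsOpen X) (hω : DifferentiableOn ℝ ω X)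
    (hω3 : ∀ i : Fin γ, 2 ≤ (i : ℕ) → ∀ ζ ∈ X, fderiv ℝ ω ζ (etaDir m i) = 0)
    (hy : ∀ k < γ, ContDiffOn ℝ 1 ((lieDeriv (drift ω))^[k] (output ψ)) X)
    {ζ : State γ m} (hζ : ζ ∈ X)
    (hne : lieDeriv (inputField γ m) ((lieDeriv (drift ω))^[γ - 1] (output ψ)) ζ ≠ 0) :
    ∃ C > 0, ∃ s ∈ 𝓝 ζ, ∀ x ∈ s, ∀ y ∈ s,
      ‖x - y‖ ≤ C * ‖errorCoord ω ψ x - errorCoord ω ψ y‖ ∧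
      ‖errorCoord ω ψ x - errorCoord ω ψ y‖ ≤ C * ‖x - y‖ := by
  have hstrict : HasStrictFDerivAt (error ω ψ) (fderiv ℝ (error ω ψ) ζ) ζ :=
    ((contDiffOn_error hy).contDiffAt (hX.mem_nhds hζ)).hasStrictFDerivAt one_ne_zero
  refine HasStrictFDerivAt.exists_norm_sub_le
    (hstrict.prodMk (hasStrictFDerivAt_snd (𝕜 := ℝ) (p := ζ))) ?_
  rintro ⟨w, z⟩ hwz
  have h2 : z = 0 := congrArg Prod.snd hwz
  subst h2
  rw [eq_zero_of_fderiv_error_apply_eq_zero hX hω hω3 hy hζ hne (congrArg Prod.fst hwz)]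
  rfl

end Triangular

/-! ### Lyapunov decay and the closed loop -/

section General

variable {E : Type*} [NormedAddCommGroup E] [NormedSpace ℝ E]

/-- The error coordinates decay exponentially under every controller of the class `𝒦`. -/
theorem IsCLF.exists_norm_error_le {γ : ℕ} {f g : E → E} {e : E → Eu γ} {X : Set E}
    {V : Eu γ → ℝ} {k₁ k₂ k₃ : ℝ} (hV : IsCLF f g e X V k₁ k₂ k₃)
    (he : ∀ x ∈ X, DifferentiableAt ℝ e x) {k : E → ℝ}
    (hk : k ∈ stabilizingControllers f g e X V k₃) :
    ∃ A > 0, ∃ κ > 0, ∀ (c : ℝ → E) (T : ℝ), IsSolutionOn (closedLoop f g k) X c (Ico 0 T) →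
      ∀ t ∈ Ico 0 T, ‖e (c t)‖ ≤ A * Real.exp (-κ * t) * ‖e (c 0)‖ := by
  have hk₁ := hV.pos₁
  have hk₂ := hV.pos₂
  refine ⟨√(k₂ / k₁), Real.sqrt_pos.2 (div_pos hk₂ hk₁), k₃ / 2, half_pos hV.pos₃, ?_⟩
  intro c T hc t ht
  have hder : ∀ s ∈ Ico 0 T, HasDerivWithinAt (fun s => Real.exp (k₃ * s) * V (e (c s)))
      (Real.exp (k₃ * s) * (k₃ * V (e (c s)) + Vdot f g e V (c s) (k (c s)))) (Ico 0 T) s := by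
    intro s hs
    obtain ⟨hX, hds⟩ := hc s hs
    have h1 : DifferentiableAt ℝ (V ∘ e) (c s) := (hV.diff _ hX).comp _ (he _ hX)
    have h2 := h1.hasFDerivAt.comp_hasDerivWithinAt s hds
    have h3 : HasDerivAt (fun s => Real.exp (k₃ * s)) (Real.exp (k₃ * s) * k₃) s := by
      simpa using ((hasDerivAt_id s).const_mul k₃).exp
    refine (h3.hasDerivWithinAt.mul h2).congr_deriv ?_
    simp only [Vdot, closedLoop, Function.comp_apply]
    ring
  have hanti : AntitoneOn (fun s => Real.exp (k₃ * s) * V (e (c s))) (Ico 0 T) := by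
    refine antitoneOn_of_hasDerivWithinAt_nonpos (convex_Ico 0 T)
      (fun s hs => (hder s hs).continuousWithinAt)
      (fun s hs => (hder s (interior_subset hs)).mono interior_subset) fun s hs => ?_
    have h1 : Vdot f g e V (c s) (k (c s)) ≤ -k₃ * V (e (c s)) :=
      hk _ (hc s (interior_subset hs)).1
    exact mul_nonpos_of_nonneg_of_nonpos (Real.exp_pos _).le (by linarith)
  have h0 : (0 : ℝ) ∈ Ico 0 T := ⟨le_rfl, ht.1.trans_lt ht.2⟩
  have hmono := hanti h0 ht ht.1
  simp only [mul_zero, Real.exp_zero, one_mul] at hmono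
  have hlow := hV.lower _ (hc t ht).1
  have hup := hV.upper _ (hc 0 h0).1
  refine le_of_sq_le_sq ?_ (by positivity)
  have h1 : Real.exp (k₃ * t) * (k₁ * ‖e (c t)‖ ^ 2) ≤ k₂ * ‖e (c 0)‖ ^ 2 :=
    ((mul_le_mul_of_nonneg_left hlow (Real.exp_pos _).le).trans hmono).trans hup
  have h2 : Real.exp (-(k₃ / 2) * t) ^ 2 = (Real.exp (k₃ * t))⁻¹ := by
    rw [← Real.exp_nat_mul, ← Real.exp_neg]
    congr 1
    push_cast
    ring
  rw [mul_pow, mul_pow, Real.sq_sqrt (by positivity), h2,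
    show k₂ / k₁ * (Real.exp (k₃ * t))⁻¹ * ‖e (c 0)‖ ^ 2 =
      k₂ * ‖e (c 0)‖ ^ 2 / (Real.exp (k₃ * t) * k₁) by field_simp, le_div_iff₀ (by positivity)]
  linarith

end General

theorem exists_lipschitzOnWith_closedLoop {ω : State γ m → Eu m} {k : State γ m → ℝ}
    {X : Set (State γ m)} {δ : ℝ} (hω : ContDiffOn ℝ 1 ω X) (hX : Metric.closedBall 0 δ ⊆ X)
    (hk : LocallyLipschitzOn X k) :
    ∃ K, LipschitzOnWith K (closedLoop (drift ω) (inputField γ m) k) (Metric.closedBall 0 δ) := by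
  obtain ⟨K₁, hK₁⟩ := (hω.mono hX).exists_lipschitzOnWith one_ne_zero (convex_closedBall 0 δ)
    (isCompact_closedBall 0 δ)
  obtain ⟨K₂, hK₂⟩ := (hk.mono hX).exists_lipschitzOnWith_of_compact (isCompact_closedBall 0 δ)
  let A : Eu γ →ₗ[ℝ] Eu γ := ⟨⟨shift, shift_add⟩, shift_smul⟩
  have hA : LipschitzWith _ (fun ζ : State γ m => shift ζ.1) :=
    (LinearMap.toContinuousLinearMap A).lipschitz.comp LipschitzWith.prod_fst
  have hdrift := hA.lipschitzOnWith.prodMk hK₁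
  -- The input field is constant, so evaluating it at 0 loses nothing.
  have hsmul := (ContinuousLinearMap.toSpanSingleton ℝ (inputField γ m 0)).lipschitz.comp_lipschitzOnWith
    hK₂
  exact ⟨_, hdrift.add hsmul⟩

variable [NeZero γ]

/-- Exponential stability of the closed loop inside a region `S` on which the zero dynamics
dominate up to the error and the coordinates `(e, z)` are comparable with the state. -/
theorem expStableOn_closedLoop {ω : State γ m → Eu m} {ψ : Eu m → Eu γ}
    {X S : Set (State γ m)} {V : Eu γ → ℝ} {k₁ k₂ k₃ : ℝ}
    (hV : IsCLF (drift ω) (inputField γ m) (error ω ψ) X V k₁ k₂ k₃)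
    (he : ∀ x ∈ X, DifferentiableAt ℝ (error ω ψ) x) {k : State γ m → ℝ}
    (hk : k ∈ stabilizingControllers (drift ω) (inputField γ m) (error ω ψ) X V k₃)
    (hSX : S ⊆ X) {w : Eu m → Eu m} {Y Y₀ : Set (Eu m)} {K : NNReal} {M lam L C : ℝ}
    (hw : LipschitzOnWith K w Y) (hY₀ : Y₀ ⊆ Y) (hM : 0 < M) (hlam : 0 < lam)
    (hφ : ∀ x ∈ Y₀, ∃ φ : ℝ → Eu m, φ 0 = x ∧ IsSolutionOn w Y φ (Ici 0) ∧
      ∀ t, 0 ≤ t → ‖φ t‖ ≤ M * Real.exp (-lam * t) * ‖x‖)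
    (hSY : ∀ ζ ∈ S, ζ.2 ∈ Y₀) (hL : 0 ≤ L)
    (hωw : ∀ ζ ∈ S, ‖ω ζ - w ζ.2‖ ≤ L * ‖error ω ψ ζ‖) (hC : 0 < C)
    (hC₁ : ∀ ζ ∈ S, ‖errorCoord ω ψ ζ‖ ≤ C * ‖ζ‖)
    (hC₂ : ∀ ζ ∈ S, ‖ζ‖ ≤ C * ‖errorCoord ω ψ ζ‖) :
    ExpStableOn (closedLoop (drift ω) (inputField γ m) k) S univ := by
  obtain ⟨A, hA, κ, hκ, hdec⟩ := hV.exists_norm_error_le he hk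
  obtain ⟨B, hB, μ, hμ, hμκ, hz⟩ := exp_decay_of_approx_solution (L := L * A) hw hY₀ hM hlam hφ hκ
    (by positivity)
  refine ⟨C * (A + B) * C, by positivity, μ, hμ, fun c T hc _ t ht => ?_⟩
  have h0 : (0 : ℝ) ∈ Ico 0 T := ⟨le_rfl, ht.1.trans_lt ht.2⟩
  have hcX := hc.mono hSX subset_rfl
  -- One scale dominating both initial data, `e` and `z`.
  set P := C * ‖c 0‖ with hP
  have hP0 : 0 ≤ P := by positivity
  have hΦ0 : ‖errorCoord ω ψ (c 0)‖ ≤ P := hC₁ _ (hc 0 h0).1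
  have he0 : ‖error ω ψ (c 0)‖ ≤ P := (norm_fst_le (errorCoord ω ψ (c 0))).trans hΦ0
  have hz0 : ‖(c 0).2‖ ≤ P := (norm_snd_le (errorCoord ω ψ (c 0))).trans hΦ0
  have het : ∀ s ∈ Ico 0 T, ‖error ω ψ (c s)‖ ≤ A * Real.exp (-κ * s) * P := fun s hs =>
    (hdec c T hcX s hs).trans (by gcongr)
  have hzt := hz (fun s => (c s).2) (fun s => ω (c s)) T P hP0 (fun s hs => hSY _ (hc s hs).1)
    (fun s hs => by
      have h1 := (hasFDerivAt_snd (𝕜 := ℝ) (p := c s)).comp_hasDerivWithinAt s (hc s hs).2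
      refine h1.congr_deriv ?_
      simp [closedLoop, drift, inputField])
    (fun s hs => by
      refine (hωw _ (hc s hs).1).trans ?_
      rw [mul_assoc L A, mul_assoc L]
      exact mul_le_mul_of_nonneg_left (het s hs) hL)
    hz0 t ht
  have het' : ‖error ω ψ (c t)‖ ≤ A * Real.exp (-μ * t) * P := by
    refine (het t ht).trans ?_
    have : -κ * t ≤ -μ * t := by nlinarith [ht.1]
    gcongr
  have hE : 0 < Real.exp (-μ * t) := Real.exp_pos _
  have hΦt : ‖errorCoord ω ψ (c t)‖ ≤ (A + B) * Real.exp (-μ * t) * P := by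
    have h1 : 0 ≤ A * Real.exp (-μ * t) * P := by positivity
    have h2 : 0 ≤ B * Real.exp (-μ * t) * P := by positivity
    refine max_le (het'.trans ?_) (hzt.trans ?_) <;> linarith
  calc ‖c t‖ ≤ C * ‖errorCoord ω ψ (c t)‖ := hC₂ _ (hc t ht).1
    _ ≤ C * ((A + B) * Real.exp (-μ * t) * P) := by gcongr
    _ = C * (A + B) * C * Real.exp (-μ * t) * ‖c 0‖ := by rw [hP]; ring

end ZDP

/-! ### The local and global theorems -/

theorem mainTheorem1 {γ m : ℕ} [NeZero γ]
    (N : Set (ZDP.Eu γ)) (Z : Set (ZDP.Eu m)) (hN : IsOpen N) (hZ : IsOpen Z)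
    (hN0 : (0 : ZDP.Eu γ) ∈ N) (hZ0 : (0 : ZDP.Eu m) ∈ Z)
    (ω : ZDP.State γ m → ZDP.Eu m) (hω : ContDiffOn ℝ 1 ω (N ×ˢ Z))
    -- `∂ω/∂η_i = 0` for `i = 3, …, γ`
    (hω3 : ∀ i : Fin γ, 2 ≤ (i : ℕ) → ∀ ζ ∈ N ×ˢ Z,
      fderiv ℝ ω ζ (EuclideanSpace.single i (1 : ℝ), 0) = 0)
    (ψ : ZDP.Eu m → ZDP.Eu γ) (hψ : DifferentiableOn ℝ ψ Z) (hψN : MapsTo ψ Z N)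
    (hψ0 : ψ 0 = 0)
    -- the output `y = η₁ - ψ₁(z)` has relative degree `γ`
    (hy : ZDP.HasRelativeDegreeAt (ZDP.drift ω) (ZDP.inputField γ m) (ZDP.output ψ)
      (N ×ˢ Z) γ 0)
    -- `M_ψ` is the zeroing manifold of `y`
    (hM : ∀ ζ ∈ ZDP.manifold N Z ψ, ZDP.error ω ψ ζ = 0)
    -- the zero dynamics are exponentially stable
    (hzero : ∃ D ∈ 𝓝 (0 : ZDP.Eu m), ZDP.ExpStableOn (ZDP.zeroDynamics ω ψ) Z D)
    (V : ZDP.Eu γ → ℝ) (k₁ k₂ k₃ : ℝ)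
    (hV : ZDP.IsCLF (ZDP.drift ω) (ZDP.inputField γ m) (ZDP.error ω ψ) (N ×ˢ Z) V k₁ k₂ k₃)
    (k : ZDP.State γ m → ℝ)
    (hk : k ∈ ZDP.stabilizingControllers (ZDP.drift ω) (ZDP.inputField γ m) (ZDP.error ω ψ)
      (N ×ˢ Z) V k₃) :
    -- exponential stability of the full state
    (∃ D ∈ 𝓝 (0 : ZDP.State γ m),
      ZDP.ExpStableOn (ZDP.closedLoop (ZDP.drift ω) (ZDP.inputField γ m) k) (N ×ˢ Z) D ∧
      (LocallyLipschitzOn (N ×ˢ Z) k →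
        ZDP.ForwardCompleteOn (ZDP.closedLoop (ZDP.drift ω) (ZDP.inputField γ m) k)
          (N ×ˢ Z) D)) ∧
    -- the global version, under global linear bounds
    (N = univ → Z = univ →
      ZDP.ExpStableOn (ZDP.zeroDynamics ω ψ) univ univ →
      (∃ L : ℝ, ∀ ζ ζ' : ZDP.State γ m,
        ‖ω ζ - ω ζ'‖ ≤ L * ‖ZDP.errorCoord ω ψ ζ - ZDP.errorCoord ω ψ ζ'‖) →
      (∃ C : ℝ, ∀ ζ : ZDP.State γ m,
        ‖ZDP.errorCoord ω ψ ζ‖ ≤ C * ‖ζ‖ ∧ ‖ζ‖ ≤ C * ‖ZDP.errorCoord ω ψ ζ‖) →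
      ZDP.ExpStableOn (ZDP.closedLoop (ZDP.drift ω) (ZDP.inputField γ m) k) univ univ ∧
      (LocallyLipschitz k →
        ZDP.ForwardCompleteOn (ZDP.closedLoop (ZDP.drift ω) (ZDP.inputField γ m) k)
          univ univ)) := by
  have hX : IsOpen (N ×ˢ Z) := hN.prod hZ
  have hX0 : (0 : ZDP.State γ m) ∈ N ×ˢ Z := ⟨hN0, hZ0⟩
  have he : ∀ ζ ∈ N ×ˢ Z, DifferentiableAt ℝ (ZDP.error ω ψ) ζ := fun ζ hζ =>
    ((ZDP.contDiffOn_error hy.smooth).differentiableOn one_ne_zero ζ hζ).differentiableAt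
      (hX.mem_nhds hζ)
  have hΦψ : ∀ z ∈ Z, ZDP.errorCoord ω ψ (ψ z, z) = (0, z) := fun z hz =>
    Prod.ext (hM _ ⟨⟨hψN hz, hz⟩, sub_self _⟩) rfl
  have hΦ0 : ZDP.errorCoord ω ψ 0 = 0 := by
    have h1 := hΦψ 0 hZ0
    rw [hψ0] at h1
    exact h1
  have hΦsub : ∀ ζ : ZDP.State γ m, ζ.2 ∈ Z →
      ‖ZDP.errorCoord ω ψ ζ - ZDP.errorCoord ω ψ (ψ ζ.2, ζ.2)‖ = ‖ZDP.error ω ψ ζ‖ := by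
    intro ζ hζ
    rw [hΦψ _ hζ, ZDP.errorCoord, Prod.mk_sub_mk, sub_zero, sub_self, Prod.norm_mk, norm_zero,
      max_eq_left (norm_nonneg _)]
  have hΦψsub : ∀ z ∈ Z, ∀ z' ∈ Z,
      ‖ZDP.errorCoord ω ψ (ψ z, z) - ZDP.errorCoord ω ψ (ψ z', z')‖ = ‖z - z'‖ := by
    intro z hz z' hz'
    rw [hΦψ _ hz, hΦψ _ hz', Prod.mk_sub_mk, sub_self, Prod.norm_mk, norm_zero,
      max_eq_right (norm_nonneg _)]
  constructor
  · obtain ⟨C, hC, s, hs, hbi⟩ := ZDP.exists_errorCoord_biLipschitz hX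
      (hω.differentiableOn one_ne_zero) hω3 hy.smooth hX0 hy.nonzero
    obtain ⟨D, hD, M, hMpos, lam, hlam, hstab⟩ := hzero
    obtain ⟨ρ, hρ, hρs⟩ := Metric.nhds_basis_closedBall.mem_iff.1
      (inter_mem hs (hX.mem_nhds hX0))
    obtain ⟨K₁, hK₁⟩ := (hω.mono fun ζ hζ => (hρs hζ).2).exists_lipschitzOnWith one_ne_zero
      (convex_closedBall 0 ρ) (isCompact_closedBall 0 ρ)
    have hψc : ContinuousAt (fun z => ((ψ z, z) : ZDP.State γ m)) 0 :=
      ((hψ 0 hZ0).differentiableAt (hZ.mem_nhds hZ0)).continuousAt.prodMk continuousAt_id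
    have hψρ : ∀ᶠ z in 𝓝 (0 : ZDP.Eu m), ((ψ z, z) : ZDP.State γ m) ∈ Metric.closedBall 0 ρ := by
      refine hψc.eventually_mem ?_
      rw [hψ0]
      exact Metric.closedBall_mem_nhds _ hρ
    obtain ⟨δ, hδ, hδs⟩ := Metric.nhds_basis_closedBall.mem_iff.1
      (inter_mem (inter_mem hD (hZ.mem_nhds hZ0)) hψρ)
    -- No Lipschitz bound on `ψ` is given; it comes from `Φ(ψ z, z) = (0, z)` and the Lipschitz
    -- inverse of `Φ`.
    have hwlip : LipschitzOnWith (K₁ * C.toNNReal) (ZDP.zeroDynamics ω ψ)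
        (Metric.closedBall 0 δ) := by
      refine LipschitzOnWith.of_dist_le_mul fun z hz z' hz' => ?_
      have h1 := hK₁.dist_le_mul _ (hδs hz).2 _ (hδs hz').2
      have h2 := (hbi _ (hρs (hδs hz).2).1 _ (hρs (hδs hz').2).1).1
      rw [hΦψsub _ (hδs hz).1.2 _ (hδs hz').1.2] at h2
      rw [dist_eq_norm] at h1 ⊢
      rw [dist_eq_norm] at h1 ⊢
      rw [NNReal.coe_mul, Real.coe_toNNReal _ hC.le, mul_assoc]
      exact h1.trans (by gcongr)
    -- Zero-dynamics solutions starting in this smaller ball stay within radius `δ`, where the field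
    -- is Lipschitz.
    have hδ' : 0 < min ρ (δ / (M + 1)) := by positivity
    set δ' := min ρ (δ / (M + 1))
    have hδ'δ : ∀ z : ZDP.Eu m, z ∈ Metric.ball 0 δ' → ‖z‖ < δ ∧ M * ‖z‖ < δ := by
      intro z hz
      have h1 : ‖z‖ < δ / (M + 1) := (mem_ball_zero_iff.1 hz).trans_le (min_le_right _ _)
      rw [lt_div_iff₀ (by positivity)] at h1
      have h2 : 0 ≤ M * ‖z‖ := by positivity
      constructor <;> linarith [norm_nonneg z]
    have hSρ : Metric.ball (0 : ZDP.State γ m) δ' ⊆ Metric.closedBall 0 ρ :=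
      Metric.ball_subset_closedBall.trans (Metric.closedBall_subset_closedBall (min_le_left _ _))
    have hSY : ∀ ζ ∈ Metric.ball (0 : ZDP.State γ m) δ', ζ.2 ∈ Metric.ball 0 δ' := fun ζ hζ =>
      mem_ball_zero_iff.2 ((norm_snd_le ζ).trans_lt (mem_ball_zero_iff.1 hζ))
    have hYδ : Metric.ball (0 : ZDP.Eu m) δ' ⊆ Metric.closedBall 0 δ := fun z hz =>
      mem_closedBall_zero_iff.2 (hδ'δ z hz).1.le
    have hρX : Metric.closedBall (0 : ZDP.State γ m) δ' ⊆ N ×ˢ Z := fun ζ hζ =>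
      (hρs (Metric.closedBall_subset_closedBall (min_le_left _ _) hζ)).2
    have hzeros : (0 : ZDP.State γ m) ∈ s := mem_of_mem_nhds hs
    have hstable : ZDP.ExpStableOn (ZDP.closedLoop (ZDP.drift ω) (ZDP.inputField γ m) k)
        (Metric.ball 0 δ') univ := by
      refine ZDP.expStableOn_closedLoop hV he hk (Metric.ball_subset_closedBall.trans hρX) hwlip
        hYδ hMpos hlam (fun z hz => ?_) hSY (L := K₁ * C) (by positivity) (fun ζ hζ => ?_) hC
        (fun ζ hζ => ?_) (fun ζ hζ => ?_)
      · obtain ⟨φ, h0, hφ, hb⟩ := ZDP.exists_decaying_solution hlam hstab hMpos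
          (fun z hz => (hδs (Metric.ball_subset_closedBall hz)).1.2) hwlip (hδs (hYδ hz)).1.1
          (hδ'δ z hz).1 (hδ'δ z hz).2
        exact ⟨φ, h0, hφ.mono Metric.ball_subset_closedBall subset_rfl, hb⟩
      -- Compare `ζ` with its companion `(ψ z, z)`: their images under `Φ` differ by `e(ζ)`.
      · have hz := hδs (hYδ (hSY ζ hζ))
        have h1 := hK₁.dist_le_mul _ (hSρ hζ) _ hz.2
        have h2 := (hbi _ (hρs (hSρ hζ)).1 _ (hρs hz.2).1).1
        rw [hΦsub ζ hz.1.2] at h2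
        rw [dist_eq_norm, dist_eq_norm] at h1
        rw [mul_assoc]
        exact h1.trans (by gcongr)
      · simpa [hΦ0] using (hbi _ (hρs (hSρ hζ)).1 _ hzeros).2
      · simpa [hΦ0] using (hbi _ (hρs (hSρ hζ)).1 _ hzeros).1
    obtain ⟨δ₀, hδ₀, hexp, hfwd⟩ := hstable.exists_ball hδ' hρX
    exact ⟨_, Metric.ball_mem_nhds _ hδ₀, hexp, fun hkl =>
      hfwd (ZDP.exists_lipschitzOnWith_closedLoop hω hρX hkl)⟩
  · rintro rfl rfl ⟨M, hMpos, lam, hlam, hstab⟩ ⟨L, hL⟩ ⟨C, hC⟩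
    rw [univ_prod_univ] at *
    -- Neither `L` nor `C` is assumed nonnegative; hence `L.toNNReal` here and `max C 1` below.
    have hL' : ∀ ζ ζ' : ZDP.State γ m, ‖ω ζ - ω ζ'‖ ≤
        L.toNNReal * ‖ZDP.errorCoord ω ψ ζ - ZDP.errorCoord ω ψ ζ'‖ := fun ζ ζ' =>
      (hL ζ ζ').trans (by gcongr; exact Real.le_coe_toNNReal L)
    have hwlip : LipschitzWith L.toNNReal (ZDP.zeroDynamics ω ψ) := by
      refine LipschitzWith.of_dist_le_mul fun z z' => ?_
      rw [dist_eq_norm, dist_eq_norm, ← hΦψsub z (mem_univ _) z' (mem_univ _)]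
      exact hL' _ _
    have hstable : ZDP.ExpStableOn (ZDP.closedLoop (ZDP.drift ω) (ZDP.inputField γ m) k)
        univ univ := by
      refine ZDP.expStableOn_closedLoop hV he hk subset_rfl (lipschitzOnWith_univ.2 hwlip)
        (subset_univ univ) hMpos hlam (fun z _ => ?_) (fun _ _ => mem_univ _)
        (L := L.toNNReal) NNReal.zero_le_coe (fun ζ _ => ?_) (C := max C 1) (by positivity)
        (fun ζ _ => ?_) (fun ζ _ => ?_)
      · have h1 : 0 ≤ M * ‖z‖ := by positivity
        obtain ⟨φ, h0, hφ, hb⟩ := ZDP.exists_decaying_solution (R := (M + 1) * ‖z‖ + 1) hlam hstab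
          hMpos (subset_univ _) hwlip.lipschitzOnWith (mem_univ z) (by linarith)
          (by linarith [norm_nonneg z])
        exact ⟨φ, h0, hφ.mono (subset_univ _) subset_rfl, hb⟩
      · rw [← hΦsub ζ (mem_univ _)]
        exact hL' _ _
      · exact (hC ζ).1.trans (by gcongr; exact le_max_left _ _)
      · exact (hC ζ).2.trans (by gcongr; exact le_max_left _ _)
    refine ⟨hstable, fun hkl => hstable.forwardCompleteOn_univ fun x => ?_⟩
    obtain ⟨K, hK⟩ := ZDP.exists_lipschitzOnWith_closedLoop (δ := ‖x‖ + 1) hω (subset_univ _)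
      hkl.locallyLipschitzOn
    refine ⟨K, _, Metric.closedBall_mem_nhds_of_mem ?_, hK⟩
    simp
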